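/- Let $\mathcal G=(V,E,w)$ be a finite directed graph with $n=|V|$ nodes, edge set $E\subseteq V\times V$ and positive edge weights $w(i,j)$, in which every node has at least one outgoing edge. Let $A$ be its weighted adjacency matrix, $d_i=\sum_j A_{ij}$ the out-degree of $i$, $D=\operatorname{diag}(d_i)$, $L=D-A$ and $P=D^{-1}A$. Let $0<\alpha<1$, $\Lambda=\frac{\alpha}{1-\alpha}D$, and let $\Pi=\alpha(I-(1-\alpha)P)^{-1}$ be the PageRank matrix. For a set $S\subseteq V$ and a node $v\in V$, put $\sigma=\frac1n\mathbf 1^\top\Pi$, $\tilde\sigma=e_v^\top\Pi$ and $\eta=\Pi\mathbf 1_S$. Let $\mathcal G_r$ be the graph with the same nodes and edges as $\mathcal G$ and edge weights $w_r(i,j)=\frac{w(i,j)}{\frac{\alpha}{1-\alpha}d_i}$, let $L_r$ be its Laplacian (out-degree matrix minus adjacency matrix), and let $\Omega=(\omega_{ij})=(L_r+I)^{-1}$ be its forest matrix. Let $\mathcal F$ be the set of spanning rooted forests of $\mathcal G_r$, that is, the spanning subgraphs that are forests and in which every tree has a root and all its edges are oriented towards that root (so that every node has at most one outgoing edge, and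 the roots are the nodes with none). For $F\in\mathcal F$, let $\varepsilon(F)$ be the product of the weights $w_r$ of its edges (the empty product being $1$), and let $M(F,i)$ be the set of nodes in the tree of $F$ rooted at $i$ (empty if $i$ is not a root). Let $\mathcal F_{ij}=\{F\in\mathcal F: j\in M(F,i)\}$, and for a set $H$ of forests let $\varepsilon(H)=\sum_{F\in H}\varepsilon(F)$. Then $D$, $I-(1-\alpha)P$, $\Lambda$, $\Lambda^{-1}L+I$ and $L_r+I$ are invertible, $\varepsilon(\mathcal F)>0$, and $$\Pi=(\Lambda^{-1}L+I)^{-1}=\Omega .$$ Moreover, for every node $s\in V$, $$\sigma_s=\frac1n\sum_{u\in V}\omega_{us}=\frac{\sum_{F\in\mathcal F}|M(F,s)|\,\varepsilon(F)}{n\,\varepsilon(\mathcal F)},\qquad \tilde\sigma_s=\omega_{vs}=\frac{\varepsilon(\mathcal F_{sv})}{\varepsilon(\mathcal F)},\qquad \eta_s=\sum_{u\in S}\omega_{su}=\frac{\sum_{u\in S}\varepsilon(\mathcal F_{us})}{\varepsilon(\mathcal F)} .$$ -/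

import Mathlib

/-- A finite weighted digraph: a set of ordered pairs as edges (self-loops are allowed) and a
positive weight on every edge. Values of `weight` off the edge set are never used. -/
structure WDigraph (V : Type*) where
  edges : Finset (V × V)
  weight : V × V → ℝ
  weight_pos : ∀ e ∈ edges, 0 < weight e

namespace WDigraph

noncomputable section

variable {V : Type*} [Fintype V] [DecidableEq V]

/-- The adjacency matrix `A`. -/
def adj (G : WDigraph V) : Matrix V V ℝ :=
  Matrix.of fun i j => if (i, j) ∈ G.edges then G.weight (i, j) else 0

/-- The (weighted) out-degree `d_i`. -/
def outDeg (G : WDigraph V) (i : V) : ℝ := ∑ j, G.adj i j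

/-- The diagonal matrix `D` of out-degrees. -/
def degMatrix (G : WDigraph V) : Matrix V V ℝ := Matrix.diagonal G.outDeg

/-- The Laplacian `L = D - A`. -/
def laplacian (G : WDigraph V) : Matrix V V ℝ := G.degMatrix - G.adj

/-- The transition matrix `P = D⁻¹ A`. -/
def transition (G : WDigraph V) : Matrix V V ℝ := G.degMatrix⁻¹ * G.adj

/-- The forest matrix `Ω = (L + I)⁻¹`. -/
def forestMatrix (G : WDigraph V) : Matrix V V ℝ := (G.laplacian + 1)⁻¹

/-- The PageRank matrix `Π = α (I - (1 - α) P)⁻¹`. -/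
def pageRankMatrix (G : WDigraph V) (α : ℝ) : Matrix V V ℝ :=
  α • (1 - (1 - α) • G.transition)⁻¹

/-- The diagonal matrix `Λ = α / (1 - α) D`. -/
def lam (G : WDigraph V) (α : ℝ) : Matrix V V ℝ := (α / (1 - α)) • G.degMatrix

/-- The row vector `σ = (1/n) 1ᵀ Π`. -/
def sigma (G : WDigraph V) (α : ℝ) : V → ℝ :=
  (1 / (Fintype.card V : ℝ)) • Matrix.vecMul (fun _ => 1) (G.pageRankMatrix α)

/-- The row vector `σ̃ = e_vᵀ Π`, for a source node `v`. -/
def sigmaTilde (G : WDigraph V) (α : ℝ) (v : V) : V → ℝ :=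
  Matrix.vecMul (Pi.single v 1) (G.pageRankMatrix α)

/-- The column vector `η = Π 1_S`, for a set `S` of nodes. -/
def eta (G : WDigraph V) (α : ℝ) (S : Finset V) : V → ℝ :=
  Matrix.mulVec (G.pageRankMatrix α) (fun u => if u ∈ S then 1 else 0)

theorem outDeg_pos (G : WDigraph V) {e : V × V} (he : e ∈ G.edges) : 0 < G.outDeg e.1 := by
  refine Finset.sum_pos' (fun j _ => ?_) ⟨e.2, Finset.mem_univ _, ?_⟩
  · simp only [adj, Matrix.of_apply]
    split_ifs with h
    · exact (G.weight_pos _ h).le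
    · exact le_rfl
  · simpa [adj, he] using G.weight_pos e he

/-- The reweighted graph `G_r`: the same nodes and edges, with
`w_r(i,j) = w(i,j) / (α / (1 - α) * d_i)`. -/
def reweight (G : WDigraph V) (α : ℝ) (h0 : 0 < α) (h1 : α < 1) : WDigraph V where
  edges := G.edges
  weight e := G.weight e / (α / (1 - α) * G.outDeg e.1)
  weight_pos e he :=
    div_pos (G.weight_pos e he)
      (mul_pos (div_pos h0 (sub_pos.mpr h1)) (G.outDeg_pos he))

/-- There is a directed path (possibly of length zero) from `i` to `j` along edges in `F`. -/
def Reaches (F : Finset (V × V)) (i j : V) : Prop :=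
  Relation.ReflTransGen (fun a b => (a, b) ∈ F) i j

/-- `F` is the edge set of a spanning rooted forest of `G`, all of whose trees are oriented towards
their roots: every node has at most one outgoing edge in `F`, and `F` has no cycle.
(When out-degrees are at most one, every cycle of the underlying undirected multigraph is a
directed cycle; self-loops and pairs of antiparallel edges are cycles.) Such an `F` determines its
roots: they are the nodes without outgoing edge, exactly one in each tree. -/
structure IsSpanningRootedForest (G : WDigraph V) (F : Finset (V × V)) : Prop where
  subset : F ⊆ G.edges
  out_unique : ∀ i j k, (i, j) ∈ F → (i, k) ∈ F → j = k
  acyclic : ∀ i, ¬ Relation.TransGen (fun a b => (a, b) ∈ F) i i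

open Classical in
/-- The set `𝓕` of all spanning rooted forests of `G`. -/
def forests (G : WDigraph V) : Finset (Finset (V × V)) :=
  G.edges.powerset.filter fun F => G.IsSpanningRootedForest F

open Classical in
/-- The root set `ρ(F)`: the nodes without outgoing edge. -/
def roots (F : Finset (V × V)) : Finset V :=
  Finset.univ.filter fun i => ∀ j, (i, j) ∉ F

open Classical in
/-- The set `M(F, i)` of the nodes that are rooted at `i` in `F` (empty if `i` is not a root). -/
def rootedAt (F : Finset (V × V)) (i : V) : Finset V :=
  Finset.univ.filter fun j => i ∈ roots F ∧ Reaches F j i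

/-- The set `𝓕_ij` of the spanning rooted forests in which `j` lies in the tree rooted at `i`. -/
def forestsRooted (G : WDigraph V) (i j : V) : Finset (Finset (V × V)) :=
  G.forests.filter fun F => j ∈ rootedAt F i

/-- The weight `ε(F)`: the product of the weights of the edges of `F`. -/
def wt (G : WDigraph V) (F : Finset (V × V)) : ℝ := ∏ e ∈ F, G.weight e

/-- The weight of a set of forests: the sum of the weights of its members. -/
def wtSet (G : WDigraph V) (H : Finset (Finset (V × V))) : ℝ := ∑ F ∈ H, G.wt F

end

end WDigraph

/-! The matrix identity is algebra: the out-degree cancels in `reweight`, which gives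
$I-(1-\alpha)P=\alpha(L_r+I)$ (`one_sub_smul_transition`). The forest formulas come from the matrix
forest theorem, proved without determinants. Let $W_{vs}=\varepsilon(\mathcal F_{sv})$; the claim is
$(L+I)W=\varepsilon(\mathcal F)I$. The $(u,s)$ entry of the difference is a weighted sum of `defect`
over forests. Forests are grouped by what remains after deleting the out-edge of $u$
(`sum_forests_eq`), and each group sums to zero (`defect_add_sum`). -/

namespace WDigraph

noncomputable section

variable {V : Type*}

/-! ### Rooted forests and the insertion of an edge. -/

theorem mem_forests {G : WDigraph V} {F : Finset (V × V)} :
    F ∈ G.forests ↔ G.IsSpanningRootedForest F := by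
  classical
  simp only [forests, Finset.mem_filter, Finset.mem_powerset, and_iff_right_iff_imp]
  exact fun h => h.subset

theorem Reaches.mono {F F' : Finset (V × V)} (h : F ⊆ F') {i j : V} (hij : Reaches F i j) :
    Reaches F' i j :=
  Relation.ReflTransGen.mono (fun _ _ hab => h hab) _ _ hij

theorem empty_mem_forests (G : WDigraph V) : ∅ ∈ G.forests := by
  refine mem_forests.mpr ⟨Finset.empty_subset _, by simp, fun i h => ?_⟩
  obtain ⟨c, hc, -⟩ := Relation.TransGen.head'_iff.mp h
  simp at hc

theorem wt_pos (G : WDigraph V) {F : Finset (V × V)} (hF : F ∈ G.forests) : 0 < G.wt F :=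
  Finset.prod_pos fun e he => G.weight_pos e ((mem_forests.mp hF).subset he)

theorem wtSet_forests_pos (G : WDigraph V) : 0 < G.wtSet G.forests :=
  Finset.sum_pos (fun _ hF => G.wt_pos hF) ⟨∅, G.empty_mem_forests⟩

theorem IsSpanningRootedForest.anti {G : WDigraph V} {F F' : Finset (V × V)}
    (hF : G.IsSpanningRootedForest F) (h : F' ⊆ F) : G.IsSpanningRootedForest F' where
  subset := h.trans hF.subset
  out_unique i j k hj hk := hF.out_unique i j k (h hj) (h hk)
  acyclic i hi := hF.acyclic i (Relation.TransGen.mono (fun _ _ hab => h hab) _ _ hi)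

variable [DecidableEq V]

/-- A path that uses the new edge can be cut before its first use and after its last, so acyclicity
is not needed. -/
theorem reaches_insert {F : Finset (V × V)} {u k i j : V} :
    Reaches (insert (u, k) F) i j ↔ Reaches F i j ∨ (Reaches F i u ∧ Reaches F k j) := by
  constructor
  · intro h
    induction h using Relation.ReflTransGen.head_induction_on with
    | refl => exact Or.inl .refl
    | head hac _ ih =>
      rcases Finset.mem_insert.mp hac with h | h
      · obtain ⟨rfl, rfl⟩ := Prod.mk.inj h
        exact Or.inr ⟨.refl, ih.elim id And.right⟩
      · exact ih.imp (fun h' => .head h h') (fun h' => ⟨.head h h'.1, h'.2⟩)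
  · rintro (h | ⟨h, h'⟩)
    · exact h.mono (Finset.subset_insert _ _)
    · refine (h.mono (Finset.subset_insert _ _)).trans (.head (Finset.mem_insert_self _ _) ?_)
      exact h'.mono (Finset.subset_insert _ _)

variable [Fintype V]

theorem mem_roots {F : Finset (V × V)} {i : V} : i ∈ roots F ↔ ∀ j, (i, j) ∉ F := by
  classical
  simp [roots]

theorem mem_rootedAt {F : Finset (V × V)} {i j : V} :
    j ∈ rootedAt F i ↔ i ∈ roots F ∧ Reaches F j i := by
  classical
  simp [rootedAt]

/-- A root reaches only itself. -/
theorem eq_of_reaches_of_mem_roots {F : Finset (V × V)} {i j : V} (hi : i ∈ roots F)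
    (h : Reaches F i j) : i = j := by
  rcases Relation.ReflTransGen.cases_head h with h | ⟨c, hc, -⟩
  · exact h
  · exact absurd hc (mem_roots.mp hi c)

/-- A node reaches at most one root. -/
theorem root_unique {G : WDigraph V} {F : Finset (V × V)} (hF : G.IsSpanningRootedForest F)
    {i r t : V} (hr : r ∈ roots F) (ht : t ∈ roots F) (hir : Reaches F i r)
    (hit : Reaches F i t) : r = t := by
  induction hir using Relation.ReflTransGen.head_induction_on with
  | refl => exact eq_of_reaches_of_mem_roots hr hit
  | head hac _ ih =>
    rcases Relation.ReflTransGen.cases_head hit with h | ⟨c, hc, hct⟩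
    · subst h
      exact absurd hac (mem_roots.mp ht _)
    · rw [hF.out_unique _ _ _ hc hac] at hct
      exact ih hct

theorem mem_roots_insert {F : Finset (V × V)} {u k s : V} :
    s ∈ roots (insert (u, k) F) ↔ s ≠ u ∧ s ∈ roots F := by
  simp only [mem_roots, Finset.mem_insert, Prod.mk.injEq, not_or, not_and]
  constructor
  · exact fun h => ⟨fun hs => (h k).1 hs rfl, fun j => (h j).2⟩
  · exact fun h j => ⟨fun hs => absurd hs h.1, h.2 j⟩

/-- Adding an edge from a root `u` to a node outside the tree of `u` gives a forest. -/
theorem IsSpanningRootedForest.insert {G : WDigraph V} {F : Finset (V × V)}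
    (hF : G.IsSpanningRootedForest F) {u k : V} (hu : u ∈ roots F) (huk : (u, k) ∈ G.edges)
    (hk : ¬ Reaches F k u) : G.IsSpanningRootedForest (insert (u, k) F) where
  subset := Finset.insert_subset huk hF.subset
  out_unique i j l hj hl := by
    rw [mem_roots] at hu
    simp only [Finset.mem_insert, Prod.mk.injEq] at hj hl
    rcases hj with ⟨rfl, rfl⟩ | hj <;> rcases hl with ⟨h, rfl⟩ | hl
    · rfl
    · exact absurd hl (hu _)
    · exact absurd (h ▸ hj) (hu _)
    · exact hF.out_unique i j l hj hl
  acyclic i hi := by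
    obtain ⟨c, hc, hci⟩ := Relation.TransGen.head'_iff.mp hi
    have hci' : Reaches (Insert.insert (u, k) F) c i := hci
    rw [reaches_insert] at hci'
    rcases Finset.mem_insert.mp hc with h | h
    · obtain ⟨rfl, rfl⟩ := Prod.mk.inj h
      exact hk (hci'.elim id And.right)
    · rcases hci' with h' | ⟨h', h''⟩
      · exact hF.acyclic i (.head' h h')
      · exact hk (h''.trans (.head h h'))

open Classical in
/-- The forests in which `u` is not a root arise from those in which it is by adding an edge from
`u` to a node in another tree. -/
theorem sum_forests_eq (G : WDigraph V) (u : V) (g : Finset (V × V) → ℝ) :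
    ∑ F ∈ G.forests, g F = ∑ H ∈ G.forests with u ∈ roots H,
      (g H + ∑ k with (u, k) ∈ G.edges ∧ ¬ Reaches H k u, g (insert (u, k) H)) := by
  rw [Finset.sum_add_distrib, ← Finset.sum_filter_add_sum_filter_not G.forests (u ∈ roots ·)]
  congr 1
  rw [Finset.sum_sigma']
  symm
  refine Finset.sum_bij (fun x _ => insert (u, x.2) x.1) ?_ ?_ ?_ (fun _ _ => rfl)
  · rintro ⟨H, k⟩ hx
    simp only [Finset.mem_sigma, Finset.mem_filter, Finset.mem_univ, true_and, mem_forests] at hx ⊢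
    exact ⟨hx.1.1.insert hx.1.2 hx.2.1 hx.2.2, fun h => (mem_roots_insert.mp h).1 rfl⟩
  · rintro ⟨H, k⟩ hx ⟨H', k'⟩ hx' h
    simp only [Finset.mem_sigma, Finset.mem_filter, mem_roots] at hx hx' h
    have hk : k = k' := by
      have : (u, k) ∈ insert (u, k') H' := h ▸ Finset.mem_insert_self _ _
      rcases Finset.mem_insert.mp this with h | h
      · exact (Prod.mk.inj h).2
      · exact absurd h (hx'.1.2 _)
    subst hk
    have : H = H' := by
      rw [← Finset.erase_insert (hx.1.2 k), h, Finset.erase_insert (hx'.1.2 k)]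
    rw [this]
  · intro F hF
    simp only [Finset.mem_filter, mem_forests, mem_roots, not_forall, not_not] at hF
    obtain ⟨hF, k, hk⟩ := hF
    have hu : u ∈ roots (F.erase (u, k)) := mem_roots.mpr fun j hj => by
      obtain ⟨hne, hj⟩ := Finset.mem_erase.mp hj
      exact hne (by rw [hF.out_unique u j k hj hk])
    refine ⟨⟨F.erase (u, k), k⟩, ?_, Finset.insert_erase hk⟩
    simp only [Finset.mem_sigma, Finset.mem_filter, Finset.mem_univ, true_and, mem_forests]
    -- A path from `k` back to `u` would close a cycle with the edge `(u, k)`.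
    exact ⟨⟨hF.anti (Finset.erase_subset _ _), hu⟩, hF.subset hk, fun h =>
      hF.acyclic u (.head' hk (h.mono (Finset.erase_subset _ _)))⟩

/-! ### The matrix forest theorem. -/

open Classical in
/-- The indicator of the event that `j` lies in the tree of `F` rooted at `i`. -/
def rootInd (F : Finset (V × V)) (i j : V) : ℝ := if i ∈ roots F ∧ Reaches F j i then 1 else 0

theorem wtSet_forestsRooted (G : WDigraph V) (i j : V) :
    G.wtSet (G.forestsRooted i j) = ∑ F ∈ G.forests, G.wt F * rootInd F i j := by
  classical
  simp only [wtSet, forestsRooted, rootInd, Finset.sum_filter, mul_ite, mul_one, mul_zero]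
  exact Finset.sum_congr rfl fun F _ => if_congr mem_rootedAt rfl rfl

theorem rootInd_self {F : Finset (V × V)} {u : V} (hu : u ∈ roots F) : rootInd F u u = 1 :=
  if_pos ⟨hu, .refl⟩

theorem rootInd_of_root {F : Finset (V × V)} {u s : V} (hu : u ∈ roots F) (h : u ≠ s) :
    rootInd F s u = 0 :=
  if_neg fun h' => h (eq_of_reaches_of_mem_roots hu h'.2)

theorem rootInd_insert_self {F : Finset (V × V)} {u k j : V} :
    rootInd (insert (u, k) F) u j = 0 :=
  if_neg fun h => (mem_roots_insert.mp h.1).1 rfl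

theorem rootInd_mul {G : WDigraph V} {F : Finset (V × V)} (hF : G.IsSpanningRootedForest F)
    {u s j : V} (h : u ≠ s) : rootInd F u j * rootInd F s j = 0 := by
  simp only [rootInd]
  split_ifs with h1 h2 <;> simp
  exact h (root_unique hF h1.1 h2.1 h1.2 h2.2)

/-- The new edge hangs the tree of `u` below `k`, so its nodes inherit the root of `k`. By
`rootInd_mul` the two cases exclude each other, hence a sum. -/
theorem rootInd_insert {G : WDigraph V} {F : Finset (V × V)} (hF : G.IsSpanningRootedForest F)
    {u k s j : V} (hu : u ∈ roots F) (h : u ≠ s) :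
    rootInd (insert (u, k) F) s j = rootInd F s j + rootInd F u j * rootInd F s k := by
  have hmul := rootInd_mul hF (j := j) h
  simp only [rootInd] at hmul ⊢
  by_cases h1 : s ∈ roots F <;> by_cases h2 : Reaches F j s <;> by_cases h3 : Reaches F j u <;>
    by_cases h4 : Reaches F k s <;> simp_all [mem_roots_insert, reaches_insert, Ne.symm h]

/-- Trades the restriction on `k` for a factor, so that sums over all nodes can be manipulated
linearly. -/
theorem sum_adj_filter (G : WDigraph V) {H : Finset (V × V)} {u : V} (hu : u ∈ roots H)
    (f : V → ℝ) [DecidablePred fun k => (u, k) ∈ G.edges ∧ ¬ Reaches H k u] :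
    ∑ k with (u, k) ∈ G.edges ∧ ¬ Reaches H k u, G.weight (u, k) * f k =
      ∑ k, G.adj u k * (1 - rootInd H u k) * f k := by
  rw [Finset.sum_filter]
  refine Finset.sum_congr rfl fun k _ => ?_
  simp only [adj, Matrix.of_apply, rootInd]
  by_cases h1 : (u, k) ∈ G.edges <;> by_cases h2 : Reaches H k u <;> simp [h1, h2, hu]

theorem wt_insert (G : WDigraph V) {H : Finset (V × V)} {u : V} (hu : u ∈ roots H) (k : V) :
    G.wt (insert (u, k) H) = G.wt H * G.weight (u, k) := by
  rw [wt, Finset.prod_insert (mem_roots.mp hu k), mul_comm, wt]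

/-- The defect, at the forest `F`, of the matrix equation `(L + I) W = ε(𝓕) I` at `(u, s)`. -/
def defect (G : WDigraph V) (u s : V) (F : Finset (V × V)) : ℝ :=
  (1 + G.outDeg u) * rootInd F s u - ∑ j, G.adj u j * rootInd F s j - if u = s then 1 else 0

/-- If `u = s`, each insertion has defect $-1$, which offsets the defect of `H`. Otherwise put
$x=\sum_j A_{uj}r_u(j)$ and $y=\sum_j A_{uj}r_s(j)$, with $r$ the root indicators of `H`: the defect
of `H` is $-y$, and the insertions contribute $(1+d_u-x)y-y(d_u-x)=y$. -/
theorem defect_add_sum (G : WDigraph V) {H : Finset (V × V)} (hH : G.IsSpanningRootedForest H)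
    {u : V} (hu : u ∈ roots H) (s : V) :
    G.defect u s H +
      ∑ k, G.adj u k * (1 - rootInd H u k) * G.defect u s (insert (u, k) H) = 0 := by
  by_cases h : u = s
  · subst h
    simp only [defect, rootInd_insert_self, rootInd_self hu, if_true, outDeg]
    simp only [mul_sub, mul_one, mul_zero, Finset.sum_const_zero, Finset.sum_sub_distrib]
    simp
    ring
  · have key : ∀ k, G.adj u k * (1 - rootInd H u k) * G.defect u s (insert (u, k) H) =
        (1 + G.outDeg u - ∑ j, G.adj u j * rootInd H u j) * (G.adj u k * rootInd H s k) -
          (∑ j, G.adj u j * rootInd H s j) * (G.adj u k - G.adj u k * rootInd H u k) := by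
      intro k
      simp only [defect, rootInd_insert hH hu h, rootInd_of_root hu h, rootInd_self hu, if_neg h,
        mul_add, Finset.sum_add_distrib, ← mul_assoc, ← Finset.sum_mul]
      -- The only surplus term contains $r_u(k)r_s(k)$, which vanishes because `k` has at most one
      -- root.
      linear_combination (-G.adj u k * (1 + G.outDeg u - ∑ j, G.adj u j * rootInd H u j)) *
        rootInd_mul hH (j := k) h
    simp only [key, Finset.sum_sub_distrib, ← Finset.mul_sum]
    simp only [defect, rootInd_of_root hu h, if_neg h, outDeg]
    ring

theorem sum_wt_mul_defect (G : WDigraph V) (u s : V) :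
    ∑ F ∈ G.forests, G.wt F * G.defect u s F = 0 := by
  classical
  rw [sum_forests_eq G u]
  refine Finset.sum_eq_zero fun H hH => ?_
  obtain ⟨hH, hu⟩ := Finset.mem_filter.mp hH
  simp only [wt_insert G hu, mul_assoc, ← Finset.mul_sum]
  rw [sum_adj_filter G hu (fun k => G.defect u s (insert (u, k) H)), ← mul_add,
    G.defect_add_sum (mem_forests.mp hH) hu, mul_zero]

/-- The matrix of the numbers `ε(𝓕_sv)`, with rows indexed by `v` and columns by `s`. -/
def rootedWtMatrix (G : WDigraph V) : Matrix V V ℝ :=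
  Matrix.of fun v s => G.wtSet (G.forestsRooted s v)

theorem laplacian_add_one_mul_rootedWtMatrix (G : WDigraph V) :
    (G.laplacian + 1) * G.rootedWtMatrix = G.wtSet G.forests • 1 := by
  ext u s
  have h := G.sum_wt_mul_defect u s
  simp only [defect, mul_sub, Finset.sum_sub_distrib, ← Finset.sum_mul] at h
  have h1 : ∑ F ∈ G.forests, G.wt F * ((1 + G.outDeg u) * rootInd F s u) =
      (1 + G.outDeg u) * G.rootedWtMatrix u s := by
    simp only [rootedWtMatrix, Matrix.of_apply, wtSet_forestsRooted, Finset.mul_sum]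
    exact Finset.sum_congr rfl fun _ _ => by ring
  have h2 : ∑ F ∈ G.forests, G.wt F * ∑ j, G.adj u j * rootInd F s j =
      ∑ j, G.adj u j * G.rootedWtMatrix j s := by
    simp only [rootedWtMatrix, Matrix.of_apply, wtSet_forestsRooted, Finset.mul_sum]
    rw [Finset.sum_comm]
    exact Finset.sum_congr rfl fun _ _ => Finset.sum_congr rfl fun _ _ => by ring
  rw [h1, h2] at h
  simp only [laplacian, degMatrix, add_mul, sub_mul, one_mul, Matrix.add_apply, Matrix.sub_apply,
    Matrix.diagonal_mul, Matrix.smul_apply, Matrix.one_apply, smul_eq_mul, wtSet]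
  rw [Matrix.mul_apply]
  linarith

theorem laplacian_add_one_mul_smul (G : WDigraph V) :
    (G.laplacian + 1) * ((G.wtSet G.forests)⁻¹ • G.rootedWtMatrix) = 1 := by
  rw [Matrix.mul_smul, laplacian_add_one_mul_rootedWtMatrix, smul_smul,
    inv_mul_cancel₀ G.wtSet_forests_pos.ne', one_smul]

theorem isUnit_laplacian_add_one (G : WDigraph V) : IsUnit (G.laplacian + 1) :=
  IsUnit.of_mul_eq_one _ G.laplacian_add_one_mul_smul

/-- The matrix forest theorem. -/
theorem forestMatrix_apply (G : WDigraph V) (v s : V) :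
    G.forestMatrix v s = G.wtSet (G.forestsRooted s v) / G.wtSet G.forests := by
  rw [forestMatrix, Matrix.inv_eq_right_inv G.laplacian_add_one_mul_smul, Matrix.smul_apply,
    smul_eq_mul, div_eq_inv_mul, rootedWtMatrix, Matrix.of_apply]

/-- Double counting of pairs of a forest and a node of its tree at `s`. -/
theorem sum_wtSet_forestsRooted (G : WDigraph V) (s : V) :
    ∑ u, G.wtSet (G.forestsRooted s u) =
      ∑ F ∈ G.forests, ((rootedAt F s).card : ℝ) * G.wt F := by
  simp only [wtSet_forestsRooted]
  rw [Finset.sum_comm]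
  refine Finset.sum_congr rfl fun F _ => ?_
  rw [← Finset.mul_sum, mul_comm]
  simp [rootInd, rootedAt]

/-! ### PageRank as the forest matrix of the reweighted graph. -/

theorem outDeg_ne_zero (G : WDigraph V) (hG : ∀ i : V, ∃ j : V, (i, j) ∈ G.edges) (i : V) :
    G.outDeg i ≠ 0 := by
  obtain ⟨j, hj⟩ := hG i
  exact (G.outDeg_pos hj).ne'

theorem isUnit_degMatrix (G : WDigraph V) (hG : ∀ i : V, ∃ j : V, (i, j) ∈ G.edges) :
    IsUnit G.degMatrix := by
  rw [degMatrix, Matrix.isUnit_diagonal, Pi.isUnit_iff]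
  exact fun i => (G.outDeg_ne_zero hG i).isUnit

theorem degMatrix_inv (G : WDigraph V) (hG : ∀ i : V, ∃ j : V, (i, j) ∈ G.edges) :
    G.degMatrix⁻¹ = Matrix.diagonal fun i => (G.outDeg i)⁻¹ := by
  refine Matrix.inv_eq_right_inv ?_
  simp [degMatrix, Matrix.diagonal_mul_diagonal, G.outDeg_ne_zero hG]

theorem lam_inv (G : WDigraph V) (hG : ∀ i : V, ∃ j : V, (i, j) ∈ G.edges) {α : ℝ} (h0 : 0 < α)
    (h1 : α < 1) : (G.lam α)⁻¹ = Matrix.diagonal fun i => (α / (1 - α) * G.outDeg i)⁻¹ := by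
  have hc : α / (1 - α) ≠ 0 := (div_pos h0 (sub_pos.mpr h1)).ne'
  refine Matrix.inv_eq_right_inv ?_
  ext i j
  by_cases h : i = j
  · subst h
    have := G.outDeg_ne_zero hG i
    simp only [lam, degMatrix, Matrix.mul_diagonal, Matrix.smul_apply, Matrix.diagonal_apply_eq,
      smul_eq_mul, Matrix.one_apply_eq]
    exact mul_inv_cancel₀ (mul_ne_zero hc this)
  · simp [lam, degMatrix, h]

theorem adj_reweight (G : WDigraph V) {α : ℝ} (h0 : 0 < α) (h1 : α < 1) (i j : V) :
    (G.reweight α h0 h1).adj i j = (α / (1 - α) * G.outDeg i)⁻¹ * G.adj i j := by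
  by_cases h : (i, j) ∈ G.edges <;> simp [adj, reweight, h, div_eq_inv_mul]

/-- The out-degree is left uncancelled so that $L_r$ is visibly $L$ with row $i$ scaled by
$\Lambda_{ii}^{-1}$. -/
theorem outDeg_reweight (G : WDigraph V) {α : ℝ} (h0 : 0 < α) (h1 : α < 1) (i : V) :
    (G.reweight α h0 h1).outDeg i = (α / (1 - α) * G.outDeg i)⁻¹ * G.outDeg i := by
  rw [outDeg]
  simp only [adj_reweight, ← Finset.mul_sum]
  rw [← outDeg]

theorem lam_inv_mul_laplacian (G : WDigraph V) (hG : ∀ i : V, ∃ j : V, (i, j) ∈ G.edges) {α : ℝ}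
    (h0 : 0 < α) (h1 : α < 1) :
    (G.lam α)⁻¹ * G.laplacian = (G.reweight α h0 h1).laplacian := by
  rw [lam_inv G hG h0 h1]
  ext i j
  simp only [Matrix.diagonal_mul, laplacian, degMatrix, Matrix.sub_apply, adj_reweight, mul_sub,
    Matrix.diagonal_apply, outDeg_reweight, mul_ite, mul_zero]

/-- Since $L_r=\frac{1-\alpha}{\alpha}(I-P)$, the right side is $(1-\alpha)(I-P)+\alpha I$. -/
theorem one_sub_smul_transition (G : WDigraph V) (hG : ∀ i : V, ∃ j : V, (i, j) ∈ G.edges) {α : ℝ}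
    (h0 : 0 < α) (h1 : α < 1) :
    1 - (1 - α) • G.transition = α • ((G.reweight α h0 h1).laplacian + 1) := by
  rw [transition, degMatrix_inv G hG]
  ext i j
  have hd := G.outDeg_ne_zero hG i
  have h0' := h0.ne'
  have h1' : 1 - α ≠ 0 := (sub_pos.mpr h1).ne'
  simp only [Matrix.sub_apply, Matrix.smul_apply, Matrix.diagonal_mul, Matrix.add_apply, laplacian,
    degMatrix, adj_reweight, Matrix.diagonal_apply, outDeg_reweight, Matrix.one_apply, smul_eq_mul]
  split_ifs <;> field_simp <;> ring

theorem isUnit_lam (G : WDigraph V) (hG : ∀ i : V, ∃ j : V, (i, j) ∈ G.edges) {α : ℝ}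
    (h0 : 0 < α) (h1 : α < 1) : IsUnit (G.lam α) :=
  (G.isUnit_degMatrix hG).smul (Units.mk0 _ (div_pos h0 (sub_pos.mpr h1)).ne')

theorem isUnit_one_sub_smul_transition (G : WDigraph V)
    (hG : ∀ i : V, ∃ j : V, (i, j) ∈ G.edges) {α : ℝ} (h0 : 0 < α) (h1 : α < 1) :
    IsUnit (1 - (1 - α) • G.transition) := by
  rw [one_sub_smul_transition G hG h0 h1]
  exact (isUnit_laplacian_add_one _).smul (Units.mk0 α h0.ne')

theorem pageRankMatrix_eq_forestMatrix (G : WDigraph V)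
    (hG : ∀ i : V, ∃ j : V, (i, j) ∈ G.edges) {α : ℝ} (h0 : 0 < α) (h1 : α < 1) :
    G.pageRankMatrix α = (G.reweight α h0 h1).forestMatrix := by
  rw [pageRankMatrix, one_sub_smul_transition G hG h0 h1, forestMatrix]
  have hu := isUnit_laplacian_add_one (G.reweight α h0 h1)
  rw [Matrix.isUnit_iff_isUnit_det] at hu
  have hinv : (α • ((G.reweight α h0 h1).laplacian + 1))⁻¹ =
      α⁻¹ • ((G.reweight α h0 h1).laplacian + 1)⁻¹ := by
    refine Matrix.inv_eq_right_inv ?_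
    rw [Matrix.smul_mul, Matrix.mul_smul, Matrix.mul_nonsing_inv _ hu, smul_smul,
      mul_inv_cancel₀ h0.ne', one_smul]
  rw [hinv, smul_smul, mul_inv_cancel₀ h0.ne', one_smul]

end

end WDigraph

theorem mainTheorem1 {V : Type*} [Fintype V] [DecidableEq V]
    (G : WDigraph V) (hG : ∀ i : V, ∃ j : V, (i, j) ∈ G.edges)
    (α : ℝ) (h0 : 0 < α) (h1 : α < 1) (S : Finset V) (v s : V) :
    let Gr : WDigraph V := G.reweight α h0 h1
    let ω : Matrix V V ℝ := Gr.forestMatrix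
    let n : ℝ := Fintype.card V
    -- all inverses and quotients below are genuine
    (IsUnit G.degMatrix ∧ IsUnit (1 - (1 - α) • G.transition) ∧ IsUnit (G.lam α) ∧
      IsUnit ((G.lam α)⁻¹ * G.laplacian + 1) ∧ IsUnit (Gr.laplacian + 1) ∧
      0 < Gr.wtSet Gr.forests) ∧
    -- the PageRank matrix is the forest matrix of the reweighted graph
    (G.pageRankMatrix α = ((G.lam α)⁻¹ * G.laplacian + 1)⁻¹ ∧ G.pageRankMatrix α = ω) ∧
    -- the three quantities
    (G.sigma α s = 1 / n * ∑ u, ω u s ∧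
      1 / n * ∑ u, ω u s =
        (∑ F ∈ Gr.forests, ((WDigraph.rootedAt F s).card : ℝ) * Gr.wt F) /
          (n * Gr.wtSet Gr.forests)) ∧
    (G.sigmaTilde α v s = ω v s ∧
      ω v s = Gr.wtSet (Gr.forestsRooted s v) / Gr.wtSet Gr.forests) ∧
    (G.eta α S s = ∑ u ∈ S, ω s u ∧
      ∑ u ∈ S, ω s u =
        (∑ u ∈ S, Gr.wtSet (Gr.forestsRooted u s)) / Gr.wtSet Gr.forests) := by
  intro Gr ω n
  have hPR : G.pageRankMatrix α = ω := G.pageRankMatrix_eq_forestMatrix hG h0 h1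
  have hL : (G.lam α)⁻¹ * G.laplacian = Gr.laplacian := G.lam_inv_mul_laplacian hG h0 h1
  have hω : ∀ u t, ω u t = Gr.wtSet (Gr.forestsRooted t u) / Gr.wtSet Gr.forests :=
    Gr.forestMatrix_apply
  refine ⟨⟨G.isUnit_degMatrix hG, G.isUnit_one_sub_smul_transition hG h0 h1,
    G.isUnit_lam hG h0 h1, ?_, Gr.isUnit_laplacian_add_one, Gr.wtSet_forests_pos⟩,
    ⟨?_, hPR⟩, ⟨?_, ?_⟩, ⟨?_, hω v s⟩, ?_, ?_⟩
  · rw [hL]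
    exact Gr.isUnit_laplacian_add_one
  · rw [hL, hPR]
    rfl
  · simp [WDigraph.sigma, hPR, Matrix.vecMul, dotProduct, n]
  · simp only [hω]
    rw [← Finset.sum_div, Gr.sum_wtSet_forestsRooted, div_mul_div_comm, one_mul]
  · simp [WDigraph.sigmaTilde, hPR]
  · simp [WDigraph.eta, hPR, Matrix.mulVec, dotProduct]
  · simp only [hω, ← Finset.sum_div]
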